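/- Let $|\phi^\pm\rangle=(|00\rangle\pm|11\rangle)/\sqrt2$ and $|\psi^\pm\rangle=(|01\rangle\pm|10\rangle)/\sqrt2$ be the Bell states, and let the fidelity of a two-qubit state $\rho$ be $\langle\phi^+|\rho|\phi^+\rangle$. For $F\in[0,1]$ let $$\rho_W(F)=F|\phi^+\rangle\langle\phi^+|+\tfrac{1-F}{3}\big(|\psi^+\rangle\langle\psi^+|+|\psi^-\rangle\langle\psi^-|+|\phi^-\rangle\langle\phi^-|\big)$$ be the Werner state of fidelity $F$, and let $$\rho_{\rm new}=F_{\rm new}|\phi^+\rangle\langle\phi^+|+\lambda_1|\psi^+\rangle\langle\psi^+|+\lambda_2|\psi^-\rangle\langle\psi^-|+\lambda_3|\phi^-\rangle\langle\phi^-|$$ be a Bell-diagonal state with $\lambda_1,\lambda_2,\lambda_3\ge0$, $F_{\rm new}+\lambda_1+\lambda_2+\lambda_3=1$ and $F_{\rm new}>1/2$. Put $\lambda_{\min}=\min(\lambda_1,\lambda_2,\lambda_3)$ and $\lambda_{\max}=\max(\lambda_1,\lambda_2,\lambda_3)$. A 2-to-1 bilocal Clifford protocol acts on two qubit pairs shared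 by two parties, in the state $\rho_W(F)\otimes\rho_{\rm new}$, as follows. For some two-qubit circuit $C$ of Hadamard, phase and CNOT gates, one party applies $C^T$ to its two qubits and the other applies $C^\dagger$ to its two qubits. Both qubits of one pair are then measured in the computational basis, and success is declared if the two outcomes agree. After a success, a local unitary $U\otimes V$ (which may depend on the outcome) may be applied to the remaining pair, provided that these local unitaries do not lower the fidelity of the output for any $F\in[1/4,1]$. Let $p(F,\rho_{\rm new})$ be the probability of success, and let the jump function $J(F,\rho_{\rm new})$ be the fidelity of the output state conditioned on success. The protocol is nontrivial if, as a function of $F\in[0,1]$, $J(F,\rho_{\rm new})$ is neither identically $F$ nor identically $F_{\rm new}$. Then every nontrivial 2-to-1 bilocal Clifford protocol satisfies the following. Let $$F^*=\frac{2F_{\rm new}-1+\sqrt{(2F_{\rm new}-1)^2-2\lambda_{\min}(1-2F_{\rm new}-2\lambda_{\min})}}{2(2F_{\rm new}-1+2\lambda_{\min})}.$$ 1. For all $F\in[\frac14,F^*]$, $a_{\rm l}F+b_{\rm l}\le J(F,\rho_{\rm new})$, where $$a_{\rm l}=\frac{2(4F^*-1)\left[2F_{\rm new}-(F_{\rm new}+\lambda_{\min})(F_{\rm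 new}+\lambda_{\max})\right]+4(\lambda_{\max}-\lambda_{\min})(1-F^*)}{(4F^*-1)\left[(4F_{\rm new}+4\lambda_{\max}-2)F^*+2-F_{\rm new}-\lambda_{\max}\right]},\qquad b_{\rm l}=\frac{F_{\rm new}+\lambda_{\min}}{2}-\frac{a_{\rm l}}{4}.$$ 2. For all $F\in[\frac14,1]$, $J(F,\rho_{\rm new})\le a_{\rm u}F+b_{\rm u}$, where $a_{\rm u}=\frac{4(1-F_{\rm new})}{3}$ and $b_{\rm u}=\frac{4F_{\rm new}-1}{3}$. 3. For all $F\in[\frac14,1]$, $\frac12\le p(F,\rho_{\rm new})\le F_{\rm new}+\lambda_{\max}$. -/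

import Mathlib

open scoped Kronecker Matrix

noncomputable section

namespace EntanglementBuffer

/-! ### Two-qubit states -/

/-- Computational basis labels of two qubits. -/
abbrev Two : Type := Fin 2 × Fin 2

/-- The computational basis vector `|ab⟩` of two qubits. -/
def ket (a b : Fin 2) : Two → ℂ := Pi.single (a, b) 1

/-- `|φ⁺⟩ = (|00⟩ + |11⟩)/√2`. -/
def phiPlus : Two → ℂ := ((√2 : ℝ) : ℂ)⁻¹ • (ket 0 0 + ket 1 1)

/-- `|ψ⁺⟩ = (|01⟩ + |10⟩)/√2`. -/
def psiPlus : Two → ℂ := ((√2 : ℝ) : ℂ)⁻¹ • (ket 0 1 + ket 1 0)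

/-- `|ψ⁻⟩ = (|01⟩ - |10⟩)/√2`. -/
def psiMinus : Two → ℂ := ((√2 : ℝ) : ℂ)⁻¹ • (ket 0 1 - ket 1 0)

/-- `|φ⁻⟩ = (|00⟩ - |11⟩)/√2`. -/
def phiMinus : Two → ℂ := ((√2 : ℝ) : ℂ)⁻¹ • (ket 0 0 - ket 1 1)

/-- The operator `|v⟩⟨v|`. -/
def ketbra (v : Two → ℂ) : Matrix Two Two ℂ := Matrix.vecMulVec v (star v)

/-- The operator `F |φ⁺⟩⟨φ⁺| + l₁ |ψ⁺⟩⟨ψ⁺| + l₂ |ψ⁻⟩⟨ψ⁻| + l₃ |φ⁻⟩⟨φ⁻|`, a state when the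
coefficients are nonnegative with sum `1`. -/
def bellDiagonal (F l₁ l₂ l₃ : ℝ) : Matrix Two Two ℂ :=
  (F : ℂ) • ketbra phiPlus + (l₁ : ℂ) • ketbra psiPlus + (l₂ : ℂ) • ketbra psiMinus +
    (l₃ : ℂ) • ketbra phiMinus

/-- The Werner state of fidelity `F`. -/
def werner (F : ℝ) : Matrix Two Two ℂ :=
  bellDiagonal F ((1 - F) / 3) ((1 - F) / 3) ((1 - F) / 3)

/-- The fidelity `⟨φ⁺|ρ|φ⁺⟩` of a two-qubit state. -/
def fidelity (ρ : Matrix Two Two ℂ) : ℝ := (star phiPlus ⬝ᵥ (ρ *ᵥ phiPlus)).re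

/-! ### Clifford circuits on two qubits -/

/-- The elementary gates: Hadamard and phase gates on either qubit, and `CNOT`s (the target is the
qubit that is not the control). -/
inductive CliffordGate : Type
  | H (qubit : Fin 2)
  | S (qubit : Fin 2)
  | CNOT (control : Fin 2)

/-- A one-qubit operator acting on the given one of two qubits. -/
def onQubit (qubit : Fin 2) (A : Matrix (Fin 2) (Fin 2) ℂ) : Matrix Two Two ℂ :=
  if qubit = 0 then A ⊗ₖ (1 : Matrix (Fin 2) (Fin 2) ℂ)
  else (1 : Matrix (Fin 2) (Fin 2) ℂ) ⊗ₖ A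

/-- The Hadamard matrix. -/
def hadamard : Matrix (Fin 2) (Fin 2) ℂ := ((√2 : ℝ) : ℂ)⁻¹ • !![1, 1; 1, -1]

/-- The phase gate `diag(1, i)`. -/
def phaseGate : Matrix (Fin 2) (Fin 2) ℂ := !![1, 0; 0, Complex.I]

/-- The matrix of `CNOT`: addition of the control bit to the target bit. -/
def cnot (control : Fin 2) : Matrix Two Two ℂ := Matrix.of fun x y =>
  if x = (if control = 0 then (y.1, y.1 + y.2) else (y.1 + y.2, y.2)) then 1 else 0

/-- The matrix of an elementary gate. -/
def CliffordGate.toMatrix : CliffordGate → Matrix Two Two ℂ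
  | .H q => onQubit q hadamard
  | .S q => onQubit q phaseGate
  | .CNOT c => cnot c

/-- A Clifford circuit on two qubits: a finite sequence of elementary gates. -/
abbrev CliffordCircuit : Type := List CliffordGate

/-- The unitary matrix implemented by a circuit. -/
def CliffordCircuit.toMatrix (c : CliffordCircuit) : Matrix Two Two ℂ :=
  (c.map CliffordGate.toMatrix).prod

/-! ### 2-to-1 bilocal Clifford protocols

Two parties share two qubit pairs; a basis label of the four qubits is `((a₁, b₁), (a₂, b₂))`, where
the first party holds `a₁, a₂` and the second party holds `b₁, b₂`. -/

/-- The operator `A ⊗ B`, with `A` acting on the two qubits `a₁, a₂` of the first party and `B` on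
the two qubits `b₁, b₂` of the second party. -/
def bilocal (A B : Matrix Two Two ℂ) : Matrix (Two × Two) (Two × Two) ℂ :=
  (A ⊗ₖ B).submatrix (Equiv.prodProdProdComm (Fin 2) (Fin 2) (Fin 2) (Fin 2))
    (Equiv.prodProdProdComm (Fin 2) (Fin 2) (Fin 2) (Fin 2))

/-- A 2-to-1 bilocal Clifford protocol. With `C` the unitary of `circuit`, the parties apply
`Cᵀ ⊗ C†`, measure both qubits of the second pair in the computational basis, and declare success
when the two outcomes agree. After success with common outcome `m` they apply the local unitary
`corrA m ⊗ corrB m` to the first pair, which they keep. (Keeping the second pair instead is the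
same as preceding the measurement by an exchange of the two pairs, which is a Clifford circuit of
three `CNOT`s.) -/
structure BilocalCliffordProtocol : Type where
  circuit : CliffordCircuit
  corrA : Fin 2 → Matrix.unitaryGroup (Fin 2) ℂ
  corrB : Fin 2 → Matrix.unitaryGroup (Fin 2) ℂ

namespace BilocalCliffordProtocol

/-- The same protocol, without any local unitaries after success. -/
def uncorrected (P : BilocalCliffordProtocol) : BilocalCliffordProtocol where
  circuit := P.circuit
  corrA := fun _ => 1
  corrB := fun _ => 1

/-- The state of both pairs after the application of `Cᵀ ⊗ C†` to `ρ₁ ⊗ ρ₂`. -/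
def rotated (P : BilocalCliffordProtocol) (ρ₁ ρ₂ : Matrix Two Two ℂ) :
    Matrix (Two × Two) (Two × Two) ℂ :=
  bilocal P.circuit.toMatrixᵀ P.circuit.toMatrixᴴ * (ρ₁ ⊗ₖ ρ₂) *
    (bilocal P.circuit.toMatrixᵀ P.circuit.toMatrixᴴ)ᴴ

/-- The unnormalised state of the first pair when both measurements on the second pair give `m`. -/
def measured (P : BilocalCliffordProtocol) (ρ₁ ρ₂ : Matrix Two Two ℂ) (m : Fin 2) :
    Matrix Two Two ℂ :=
  (P.rotated ρ₁ ρ₂).submatrix (fun x => (x, (m, m))) (fun x => (x, (m, m)))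

/-- The probability of success on the input `ρ₁ ⊗ ρ₂`. -/
def successProbOn (P : BilocalCliffordProtocol) (ρ₁ ρ₂ : Matrix Two Two ℂ) : ℝ :=
  (∑ m : Fin 2, (P.measured ρ₁ ρ₂ m).trace).re

/-- The output state conditioned on success. -/
def output (P : BilocalCliffordProtocol) (ρ₁ ρ₂ : Matrix Two Two ℂ) : Matrix Two Two ℂ :=
  ((P.successProbOn ρ₁ ρ₂ : ℝ) : ℂ)⁻¹ •
    ∑ m : Fin 2, ((P.corrA m).1 ⊗ₖ (P.corrB m).1) * P.measured ρ₁ ρ₂ m *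
      ((P.corrA m).1 ⊗ₖ (P.corrB m).1)ᴴ

/-- The success probability `p(F, ρnew)` on a Werner state of fidelity `F` and the state `ρnew`. -/
def successProb (P : BilocalCliffordProtocol) (F : ℝ) (ρnew : Matrix Two Two ℂ) : ℝ :=
  P.successProbOn (werner F) ρnew

/-- The jump function `J(F, ρnew)`: the fidelity of the output after a success on a Werner state of
fidelity `F` and the state `ρnew`. -/
def jump (P : BilocalCliffordProtocol) (F : ℝ) (ρnew : Matrix Two Two ℂ) : ℝ :=
  fidelity (P.output (werner F) ρnew)

end BilocalCliffordProtocol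

/-! ### The coefficients of the bounds, as functions of `Fnew` and of the smallest (`lmin`) and the
largest (`lmax`) of the other Bell coefficients -/

/-- The fidelity `F*`. -/
def Fstar (Fnew lmin : ℝ) : ℝ :=
  (2 * Fnew - 1 + √((2 * Fnew - 1) ^ 2 - 2 * lmin * (1 - 2 * Fnew - 2 * lmin))) /
    (2 * (2 * Fnew - 1 + 2 * lmin))

/-- The slope `a_l` of the lower bound. -/
def aLower (Fnew lmin lmax : ℝ) : ℝ :=
  (2 * (4 * Fstar Fnew lmin - 1) * (2 * Fnew - (Fnew + lmin) * (Fnew + lmax)) +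
      4 * (lmax - lmin) * (1 - Fstar Fnew lmin)) /
    ((4 * Fstar Fnew lmin - 1) *
      ((4 * Fnew + 4 * lmax - 2) * Fstar Fnew lmin + 2 - Fnew - lmax))

/-- The intercept `b_l` of the lower bound. -/
def bLower (Fnew lmin lmax : ℝ) : ℝ :=
  (Fnew + lmin) / 2 - aLower Fnew lmin lmax / 4

/-- The slope `a_u` of the upper bound. -/
def aUpper (Fnew : ℝ) : ℝ := 4 * (1 - Fnew) / 3

/-- The intercept `b_u` of the upper bound. -/
def bUpper (Fnew : ℝ) : ℝ := (4 * Fnew - 1) / 3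

end EntanglementBuffer

end

/-! Up to phases, `Cᵀ ⊗ C†` permutes products of Bell vectors. Labelling these by bits, the
permutation `σ` fixes the label `0` of `|φ⁺⟩|φ⁺⟩` and preserves the symplectic form
(`CliffordCircuit.exists_label`). Agreement of the outcomes selects a zero first bit in the second
label, that is, orthogonality to `(0, (0, 1))`. Pulled back by `σ`, the success probability is the
input weight orthogonal to the single label `v = σ⁻¹ (0, (0, 1))`, and the weight of `|φ⁺⟩` is the
input weight of `0` and `v`.

Local unitaries cannot help (`exists_jump_eq`): at `F = 1` the weight of `|φ⁺⟩` exceeds half, so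
averaging it with the other Bell weights would lower the fidelity.

Write `v = (a, b)`. If `a = 0` the jump function is `F`; if `b = 0` it is `Fnew`. Otherwise, since a
Werner state treats the three other Bell vectors alike, only the coefficient `l` of `ρnew` at `b`
matters, and `jumpFormula` results (`jump_cases`). The bounds then become inequalities in `Fnew`,
`l`, `F`. The lower one combines concavity in `F` with monotonicity in `l` at `F*`; the upper one is
affine in `l` after clearing the denominator. -/

noncomputable section

namespace EntanglementBuffer

/-! ### Inequalities for the jump function -/

/-- The fidelity after success, for a Bell coefficient `l` of the state of fidelity `f`. -/
def jumpFormula (f l F : ℝ) : ℝ :=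
  (F * f + (1 - F) / 3 * l) / ((2 - 2 * F + (f + l) * (4 * F - 1)) / 3)

/-- The expression is affine in `F`, with value `1/2` at `1/4` and `s` at `1`. -/
theorem half_le_prob {s F : ℝ} (hs : 1 / 2 ≤ s) (hF : 1 / 4 ≤ F) :
    1 / 2 ≤ (2 - 2 * F + s * (4 * F - 1)) / 3 := by
  nlinarith [mul_nonneg (sub_nonneg.2 hs) (sub_nonneg.2 hF)]

theorem prob_le {s F : ℝ} (hs : 1 / 2 ≤ s) (hF : F ≤ 1) :
    (2 - 2 * F + s * (4 * F - 1)) / 3 ≤ s := by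
  nlinarith [mul_nonneg (sub_nonneg.2 hs) (sub_nonneg.2 hF)]

theorem jumpFormula_le {f l F : ℝ} (hf : 1 / 2 < f) (hl : 0 ≤ l) (hfl : f + l ≤ 1)
    (hF : 1 / 4 ≤ F) (hF1 : F ≤ 1) : jumpFormula f l F ≤ aUpper f * F + bUpper f := by
  have hp := half_le_prob (s := f + l) (by linarith) hF
  rw [jumpFormula, div_le_iff₀ (by linarith), aUpper, bUpper]
  -- In terms of `t` the denominator is `1/2 + (f + l - 1/2) t` and the bound is `f + (1 - f) t`.
  obtain ⟨t, rfl⟩ : ∃ t, F = (1 + 3 * t) / 4 := ⟨(4 * F - 1) / 3, by ring⟩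
  have ht : 0 ≤ t := by linarith
  have ht1 : 0 ≤ 1 - t := by linarith
  have h0 : 0 ≤ (1 - t) * (f / 4 - t * ((1 - f) * (f - 1 / 2))) := by
    refine mul_nonneg ht1 ?_
    have h1 : (1 - f) * (f - 1 / 2) ≤ 1 / 16 := by nlinarith [sq_nonneg (f - 3 / 4)]
    have h2 : 0 ≤ (1 - f) * (f - 1 / 2) := mul_nonneg (by linarith) (by linarith)
    nlinarith
  have h1 : 0 ≤ 2 * f - 1 + (3 - 4 * f) * t + 2 * (1 - f) * t ^ 2 := by
    have e : 2 * f - 1 + (3 - 4 * f) * t + 2 * (1 - f) * t ^ 2 =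
      (2 * f - 1) * (1 - t) + 2 * (1 - f) * (t + t ^ 2) := by ring
    rw [e]
    have : 0 ≤ 1 - f := by linarith
    have : 0 ≤ 2 * f - 1 := by linarith
    positivity
  -- Bound times denominator minus numerator is affine in `l`, so `1 - f` times it interpolates its
  -- values at `l = 0` (`h0`) and `l = 1 - f` (`h1`).
  have h2 : 0 ≤ (1 - f - l) * ((1 - t) * (f / 4 - t * ((1 - f) * (f - 1 / 2)))) +
      l * ((2 * f - 1 + (3 - 4 * f) * t + 2 * (1 - f) * t ^ 2) / 4) :=
    add_nonneg (mul_nonneg (by linarith) h0) (mul_nonneg hl (by linarith))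
  -- The added term keeps the factor positive when `f = 1`, which forces `l = 0`.
  refine le_of_mul_le_mul_left ?_ (show 0 < 1 - f + (if f = 1 then 1 else 0) by
    split_ifs <;> grind)
  split_ifs with hf1
  · obtain rfl : l = 0 := by linarith
    subst hf1
    nlinarith
  · nlinarith

/-- Concavity of the jump function: it lies above its chords. -/
theorem chord_le_jumpFormula {f l F G : ℝ} (hf : 1 / 2 < f) (hl : 0 ≤ l) (hfl : f + l ≤ 1)
    (hF : 1 / 4 ≤ F) (hFG : F ≤ G) :
    (G - F) * ((f + l) / 2) + (F - 1 / 4) * jumpFormula f l G ≤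
      (G - 1 / 4) * jumpFormula f l F := by
  have hp := half_le_prob (s := f + l) (by linarith) hF
  have hq := half_le_prob (s := f + l) (by linarith) (hF.trans hFG)
  -- The value at `1/4` is `(f + l)/2`, and the gap between graph and chord factors completely.
  have e : (G - 1 / 4) * jumpFormula f l F -
      ((G - F) * ((f + l) / 2) + (F - 1 / 4) * jumpFormula f l G) =
      (F - 1 / 4) * (G - F) * (G - 1 / 4) * (2 * (f + l) - 1) * (8 * f - 4 * (f + l) ^ 2) / 9 /
        (((2 - 2 * F + (f + l) * (4 * F - 1)) / 3) *
          ((2 - 2 * G + (f + l) * (4 * G - 1)) / 3)) := by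
    rw [jumpFormula, jumpFormula]
    generalize hpe : (2 - 2 * F + (f + l) * (4 * F - 1)) / 3 = p at *
    generalize hqe : (2 - 2 * G + (f + l) * (4 * G - 1)) / 3 = q at *
    have hp' : p ≠ 0 := by linarith
    have hq' : q ≠ 0 := by linarith
    field_simp
    rw [← hpe, ← hqe]
    ring
  rw [← sub_nonneg, e]
  have : 0 ≤ F - 1 / 4 := by linarith
  have : 0 ≤ G - F := by linarith
  have : 0 ≤ G - 1 / 4 := by linarith
  have : 0 ≤ 2 * (f + l) - 1 := by linarith
  have : 0 ≤ 8 * f - 4 * (f + l) ^ 2 := by nlinarith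
  exact div_nonneg (by positivity) (mul_nonneg (by linarith) (by linarith))

/-- Cross-multiplication leaves the sign of `f(4F-1)² - 2(1-F)²`. At `f = 1/2` this is
`(6F-3)(2F+1)/2`, whence the threshold `F = 1/2`. -/
theorem jumpFormula_anti {f l m F : ℝ} (hf : 1 / 2 < f) (hl : 0 ≤ l) (hlm : l ≤ m)
    (hF : 1 / 2 ≤ F) : jumpFormula f m F ≤ jumpFormula f l F := by
  have hp := half_le_prob (s := f + l) (F := F) (by linarith) (by linarith)
  have hq := half_le_prob (s := f + m) (F := F) (by linarith) (by linarith)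
  rw [jumpFormula, jumpFormula, div_le_div_iff₀ (by linarith) (by linarith), ← sub_nonneg]
  have e : (F * f + (1 - F) / 3 * l) * ((2 - 2 * F + (f + m) * (4 * F - 1)) / 3) -
      (F * f + (1 - F) / 3 * m) * ((2 - 2 * F + (f + l) * (4 * F - 1)) / 3) =
      (m - l) * (f * (4 * F - 1) ^ 2 - 2 * (1 - F) ^ 2) / 9 := by ring
  rw [e]
  have : 0 ≤ f * (4 * F - 1) ^ 2 - 2 * (1 - F) ^ 2 := by nlinarith
  have : 0 ≤ m - l := by linarith
  positivity

/-- The square root is at least `2m`. This is the only property of `F*` that the lower bound needs.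
-/
theorem half_le_Fstar {f m : ℝ} (hf : 1 / 2 < f) (hm : 0 ≤ m) : 1 / 2 ≤ Fstar f m := by
  rw [Fstar, le_div_iff₀ (by linarith)]
  have : 2 * m ≤ √((2 * f - 1) ^ 2 - 2 * m * (1 - 2 * f - 2 * m)) :=
    Real.le_sqrt_of_sq_le (by nlinarith [mul_nonneg hm (show 0 ≤ 2 * f - 1 by linarith)])
  linarith

/-- The lower bound is the chord from `(1/4, (Fnew + lmin)/2)` to the point over `F*` on the graph
of the jump function for `lmax`. -/
theorem aLower_mul_Fstar_add_bLower {f m M : ℝ} (hf : 1 / 2 < f) (hm : 0 ≤ m) (hmM : m ≤ M) :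
    aLower f m M * Fstar f m + bLower f m M = jumpFormula f M (Fstar f m) := by
  have hG := half_le_Fstar hf hm
  have hp := half_le_prob (s := f + M) (F := Fstar f m) (by linarith) (by linarith)
  rw [bLower, aLower, jumpFormula]
  generalize Fstar f m = G at *
  have h1 : 4 * G - 1 ≠ 0 := by linarith
  have h2 : (4 * f + 4 * M - 2) * G + 2 - f - M =
    3 * ((2 - 2 * G + (f + M) * (4 * G - 1)) / 3) := by ring
  rw [h2]
  generalize hpe : (2 - 2 * G + (f + M) * (4 * G - 1)) / 3 = p at *
  have hp' : p ≠ 0 := by linarith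
  field_simp
  rw [← hpe]
  ring

/-- The line of the lower bound lies below the chord for `l` at both ends: at `1/4` because `m ≤ l`,
at `F*` because the jump function decreases in `l` there. -/
theorem aLower_mul_add_bLower_le {f m l M F : ℝ} (hf : 1 / 2 < f) (hm : 0 ≤ m) (hml : m ≤ l)
    (hlM : l ≤ M) (hfl : f + l ≤ 1) (hF : 1 / 4 ≤ F) (hFs : F ≤ Fstar f m) :
    aLower f m M * F + bLower f m M ≤ jumpFormula f l F := by
  have hG := half_le_Fstar hf hm
  have h1 := chord_le_jumpFormula hf (hm.trans hml) hfl hF hFs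
  have h2 := jumpFormula_anti hf (hm.trans hml) hlM hG
  have h3 := aLower_mul_Fstar_add_bLower hf hm (hml.trans hlM)
  refine le_of_mul_le_mul_left ?_ (show 0 < Fstar f m - 1 / 4 by linarith)
  have h4 : aLower f m M * (1 / 4) + bLower f m M = (f + m) / 2 := by rw [bLower]; ring
  calc (Fstar f m - 1 / 4) * (aLower f m M * F + bLower f m M)
      = (Fstar f m - F) * (aLower f m M * (1 / 4) + bLower f m M) +
        (F - 1 / 4) * (aLower f m M * Fstar f m + bLower f m M) := by ring
    _ ≤ (Fstar f m - F) * ((f + l) / 2) + (F - 1 / 4) * jumpFormula f l (Fstar f m) := by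
        rw [h4, h3]
        have : 0 ≤ Fstar f m - F := by linarith
        have : 0 ≤ F - 1 / 4 := by linarith
        gcongr
    _ ≤ _ := h1

/-! ### Bell labels -/

/-- The Bell vector with label `(x, z)`, that is, `(XˣZᶻ ⊗ 1)|φ⁺⟩` up to a sign. -/
def bellVec (k : Two) (x : Two) : ℂ :=
  ((√2 : ℝ) : ℂ)⁻¹ * (if x.1 + x.2 = k.1 then (if k.2 = 1 ∧ x.1 = 1 then -1 else 1) else 0)

/-- The coefficient of the Bell vector with label `k` in `bellDiagonal`. -/
def bellCoeff (F l₁ l₂ l₃ : ℝ) (k : Two) : ℝ :=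
  if k.1 = 0 then (if k.2 = 0 then F else l₃) else (if k.2 = 0 then l₁ else l₂)

/-- The symplectic form on the labels of pairs of Bell vectors. -/
def symplecticForm (k l : Two × Two) : Fin 2 :=
  k.1.1 * l.1.2 + k.1.2 * l.1.1 + (k.2.1 * l.2.2 + k.2.2 * l.2.1)

/-- The product of two Bell vectors. -/
def bellVec₂ (k : Two × Two) (x : Two × Two) : ℂ := bellVec k.1 x.1 * bellVec k.2 x.2

/-- The projector onto a product of two Bell vectors. -/
def bellProj₂ (k : Two × Two) : Matrix (Two × Two) (Two × Two) ℂ :=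
  Matrix.vecMulVec (bellVec₂ k) (star (bellVec₂ k))

theorem inv_sqrt_two_mul_self : ((√2 : ℝ) : ℂ)⁻¹ * ((√2 : ℝ) : ℂ)⁻¹ = 1 / 2 := by
  rw [← mul_inv, ← Complex.ofReal_mul, Real.mul_self_sqrt (by norm_num)]
  norm_num

theorem phiPlus_eq : phiPlus = bellVec (0, 0) := by
  ext ⟨a, b⟩
  fin_cases a <;> fin_cases b <;> simp [phiPlus, bellVec, ket]

theorem psiPlus_eq : psiPlus = bellVec (1, 0) := by
  ext ⟨a, b⟩
  fin_cases a <;> fin_cases b <;> simp [psiPlus, bellVec, ket]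

theorem psiMinus_eq : psiMinus = bellVec (1, 1) := by
  ext ⟨a, b⟩
  fin_cases a <;> fin_cases b <;> simp [psiMinus, bellVec, ket]

theorem phiMinus_eq : phiMinus = bellVec (0, 1) := by
  ext ⟨a, b⟩
  fin_cases a <;> fin_cases b <;> simp [phiMinus, bellVec, ket]

theorem bellDiagonal_eq_sum (F l₁ l₂ l₃ : ℝ) :
    bellDiagonal F l₁ l₂ l₃ =
      ∑ k : Two, (bellCoeff F l₁ l₂ l₃ k : ℂ) • ketbra (bellVec k) := by
  simp only [bellDiagonal, phiPlus_eq, psiPlus_eq, psiMinus_eq, phiMinus_eq, bellCoeff,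
    Fintype.sum_prod_type, Fin.sum_univ_two, Fin.isValue, if_true, one_ne_zero, if_false]
  abel

theorem ketbra_kronecker (k l : Two) :
    ketbra (bellVec k) ⊗ₖ ketbra (bellVec l) = bellProj₂ (k, l) := by
  ext x y
  simp only [ketbra, bellProj₂, bellVec₂, Matrix.kroneckerMap_apply, Matrix.vecMulVec_apply,
    Pi.star_apply, star_mul']
  ring

theorem bellDiagonal_kronecker (F l₁ l₂ l₃ F' m₁ m₂ m₃ : ℝ) :
    bellDiagonal F l₁ l₂ l₃ ⊗ₖ bellDiagonal F' m₁ m₂ m₃ =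
      ∑ k : Two × Two,
        ((bellCoeff F l₁ l₂ l₃ k.1 * bellCoeff F' m₁ m₂ m₃ k.2 : ℝ) : ℂ) • bellProj₂ k := by
  rw [bellDiagonal_eq_sum, bellDiagonal_eq_sum]
  ext x y
  simp only [Matrix.kroneckerMap_apply, Matrix.sum_apply, Matrix.smul_apply,
    smul_eq_mul, Finset.sum_mul_sum, Complex.ofReal_mul,
    Fintype.sum_prod_type (α₁ := Two)]
  refine Finset.sum_congr rfl fun i _ => Finset.sum_congr rfl fun j _ => ?_
  rw [← ketbra_kronecker, Matrix.kroneckerMap_apply]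
  ring

/-! ### Action of the gates on the Bell vectors -/

theorem bilocal_mul (A B A' B' : Matrix Two Two ℂ) :
    bilocal (A * A') (B * B') = bilocal A B * bilocal A' B' := by
  rw [bilocal, bilocal, bilocal, Matrix.mul_kronecker_mul, Matrix.submatrix_mul_equiv]

theorem bilocal_one : bilocal 1 1 = 1 := by
  rw [bilocal, Matrix.one_kronecker_one, Matrix.submatrix_one_equiv]

theorem bilocal_onQubit (q : Fin 2) (A B : Matrix (Fin 2) (Fin 2) ℂ) :
    bilocal (onQubit q A) (onQubit q B) = if q = 0 then (A ⊗ₖ B) ⊗ₖ 1 else 1 ⊗ₖ (A ⊗ₖ B) := by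
  rw [← Matrix.one_kronecker_one (m := Fin 2) (n := Fin 2)]
  split_ifs with h <;> ext x y <;>
    simp only [bilocal, onQubit, h, if_true, if_false, Matrix.submatrix_apply,
      Matrix.kroneckerMap_apply, Equiv.prodProdProdComm_apply] <;> ring

theorem onQubit_transpose (q : Fin 2) (A : Matrix (Fin 2) (Fin 2) ℂ) :
    (onQubit q A)ᵀ = onQubit q Aᵀ := by
  unfold onQubit
  split_ifs <;> simp [← Matrix.kroneckerMap_transpose]

theorem onQubit_conjTranspose (q : Fin 2) (A : Matrix (Fin 2) (Fin 2) ℂ) :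
    (onQubit q A)ᴴ = onQubit q Aᴴ := by
  unfold onQubit
  split_ifs <;> simp [Matrix.conjTranspose_kronecker]

/-- A unimodular phase cancels in a projector. -/
theorem bellProj₂_conj {M : Matrix (Two × Two) (Two × Two) ℂ} {k l : Two × Two} {μ : ℂ}
    (hμ : μ * star μ = 1) (h : M *ᵥ bellVec₂ k = μ • bellVec₂ l) :
    M * bellProj₂ k * Mᴴ = bellProj₂ l := by
  rw [bellProj₂, Matrix.mul_vecMulVec, Matrix.vecMulVec_mul, ← Matrix.star_mulVec, h, bellProj₂]
  ext x y
  simp only [Matrix.vecMulVec_apply, Pi.star_apply, Pi.smul_apply, smul_eq_mul, star_mul']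
  linear_combination (bellVec₂ l x * star (bellVec₂ l y)) * hμ

theorem kronecker_one_mulVec_bellVec₂ {A : Matrix Two Two ℂ} {k l : Two} {μ : ℂ}
    (h : A *ᵥ bellVec k = μ • bellVec l) (j : Two) :
    (A ⊗ₖ (1 : Matrix Two Two ℂ)) *ᵥ bellVec₂ (k, j) = μ • bellVec₂ (l, j) := by
  ext x
  have := congrFun h x.1
  simp only [Matrix.mulVec, dotProduct, Pi.smul_apply, smul_eq_mul] at this
  simp only [Matrix.mulVec, dotProduct, Pi.smul_apply, smul_eq_mul, bellVec₂,
    Matrix.kroneckerMap_apply, Fintype.sum_prod_type (α₁ := Two), Matrix.one_apply, mul_ite, mul_one,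
    mul_zero, ite_mul, zero_mul, Finset.sum_ite_eq, Finset.mem_univ, if_true]
  rw [← mul_assoc, ← this, Finset.sum_mul]
  exact Finset.sum_congr rfl fun i _ => by ring

theorem one_kronecker_mulVec_bellVec₂ {A : Matrix Two Two ℂ} {k l : Two} {μ : ℂ}
    (h : A *ᵥ bellVec k = μ • bellVec l) (j : Two) :
    ((1 : Matrix Two Two ℂ) ⊗ₖ A) *ᵥ bellVec₂ (j, k) = μ • bellVec₂ (j, l) := by
  ext x
  have := congrFun h x.2
  simp only [Matrix.mulVec, dotProduct, Pi.smul_apply, smul_eq_mul] at this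
  simp only [Matrix.mulVec, dotProduct, Pi.smul_apply, smul_eq_mul, bellVec₂,
    Matrix.kroneckerMap_apply, Fintype.sum_prod_type_right (α₁ := Two), Matrix.one_apply,
    ite_mul, one_mul, zero_mul, Finset.sum_ite_eq, Finset.mem_univ, if_true]
  rw [mul_left_comm, ← this, Finset.mul_sum]
  exact Finset.sum_congr rfl fun i _ => by ring

/-- The map of labels effected by `Hᵀ ⊗ H†`. -/
def hadamardLabel : Equiv.Perm Two := Equiv.prodComm _ _

/-- The map of labels effected by `Sᵀ ⊗ S†`. -/
def phaseLabel : Equiv.Perm Two where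
  toFun k := (k.1, k.2 + k.1)
  invFun k := (k.1, k.2 + k.1)
  left_inv := by decide
  right_inv := by decide

/-- The map of labels of pairs effected by two `CNOT`s. -/
def cnotLabel (c : Fin 2) : Equiv.Perm (Two × Two) where
  toFun k := if c = 0 then ((k.1.1, k.1.2 + k.2.2), (k.2.1 + k.1.1, k.2.2))
    else ((k.1.1 + k.2.1, k.1.2), (k.2.1, k.2.2 + k.1.2))
  invFun k := if c = 0 then ((k.1.1, k.1.2 + k.2.2), (k.2.1 + k.1.1, k.2.2))
    else ((k.1.1 + k.2.1, k.1.2), (k.2.1, k.2.2 + k.1.2))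
  left_inv := by revert c; decide
  right_inv := by revert c; decide

/-- A map of labels acting on one of two pairs. -/
def onPair (q : Fin 2) (e : Equiv.Perm Two) : Equiv.Perm (Two × Two) :=
  if q = 0 then e.prodCongr (Equiv.refl _) else (Equiv.refl _).prodCongr e

theorem hadamard_mulVec_bellVec (k : Two) : ∃ μ : ℂ, μ * star μ = 1 ∧
    (hadamardᵀ ⊗ₖ hadamardᴴ) *ᵥ bellVec k = μ • bellVec (hadamardLabel k) := by
  -- The singlet acquires the determinant of the Hadamard matrix.
  refine ⟨if k = (1, 1) then -1 else 1, by split_ifs <;> simp, ?_⟩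
  ext ⟨a, b⟩
  obtain ⟨x, z⟩ := k
  fin_cases x <;> fin_cases z <;> fin_cases a <;> fin_cases b <;>
    simp [Matrix.mulVec, dotProduct, Fintype.sum_prod_type, Fin.sum_univ_two, hadamard, bellVec,
      hadamardLabel, inv_sqrt_two_mul_self, mul_assoc] <;> ring

theorem phaseGate_mulVec_bellVec (k : Two) : ∃ μ : ℂ, μ * star μ = 1 ∧
    (phaseGateᵀ ⊗ₖ phaseGateᴴ) *ᵥ bellVec k = μ • bellVec (phaseLabel k) := by
  refine ⟨if k.1 = 1 then -Complex.I else 1, by split_ifs <;> simp, ?_⟩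
  ext ⟨a, b⟩
  obtain ⟨x, z⟩ := k
  fin_cases x <;> fin_cases z <;> fin_cases a <;> fin_cases b <;>
    simp [Matrix.mulVec, dotProduct, Fintype.sum_prod_type, Fin.sum_univ_two, phaseGate, bellVec,
      phaseLabel]

theorem cnot_transpose (c : Fin 2) : (cnot c)ᵀ = cnot c := by
  have h : ∀ c : Fin 2, ∀ x y : Two,
      (y = if c = 0 then (x.1, x.1 + x.2) else (x.1 + x.2, x.2)) ↔
        x = if c = 0 then (y.1, y.1 + y.2) else (y.1 + y.2, y.2) := by decide
  ext x y
  simp only [cnot, Matrix.transpose_apply, Matrix.of_apply, h c x y]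

theorem cnot_conjTranspose (c : Fin 2) : (cnot c)ᴴ = cnot c := by
  rw [Matrix.conjTranspose, cnot_transpose]
  ext x y
  simp only [cnot, Matrix.map_apply, Matrix.of_apply]
  split_ifs <;> simp

theorem cnot_mulVec_bellVec₂ (c : Fin 2) (k : Two × Two) :
    bilocal (cnot c) (cnot c) *ᵥ bellVec₂ k = bellVec₂ (cnotLabel c k) := by
  let π : Two × Two → Two × Two := fun x =>
    if c = 0 then ((x.1.1, x.1.2), (x.1.1 + x.2.1, x.1.2 + x.2.2))
    else ((x.1.1 + x.2.1, x.1.2 + x.2.2), (x.2.1, x.2.2))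
  have hπ : ∀ x y : Two × Two, bilocal (cnot c) (cnot c) x y = if y = π x then 1 else 0 := by
    intro x y
    have h : ∀ c : Fin 2, ∀ x y : Two × Two,
        (y = if c = 0 then ((x.1.1, x.1.2), (x.1.1 + x.2.1, x.1.2 + x.2.2))
          else ((x.1.1 + x.2.1, x.1.2 + x.2.2), (x.2.1, x.2.2))) ↔
        ((x.1.1, x.2.1) = (if c = 0 then (y.1.1, y.1.1 + y.2.1) else (y.1.1 + y.2.1, y.2.1)) ∧
          (x.1.2, x.2.2) =
            (if c = 0 then (y.1.2, y.1.2 + y.2.2) else (y.1.2 + y.2.2, y.2.2))) := by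
      decide
    simp only [π, h c x y, bilocal, Matrix.submatrix_apply, Equiv.prodProdProdComm_apply,
      Matrix.kroneckerMap_apply, cnot, Matrix.of_apply, ite_and, ite_mul, one_mul, zero_mul]
  ext x
  simp only [Matrix.mulVec, dotProduct, hπ, ite_mul, one_mul, zero_mul, Finset.sum_ite_eq',
    Finset.mem_univ, if_true, bellVec₂, bellVec]
  -- Up to the common factor `1/2` the entries are signs or zero, so the identity is decidable over
  -- `ℤ`.
  have key : ∀ c : Fin 2, ∀ k x : Two × Two,
      ∀ y, y = (if c = 0 then ((x.1.1, x.1.2), (x.1.1 + x.2.1, x.1.2 + x.2.2))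
          else ((x.1.1 + x.2.1, x.1.2 + x.2.2), (x.2.1, x.2.2))) →
      ((if y.1.1 + y.1.2 = k.1.1 then (if k.1.2 = 1 ∧ y.1.1 = 1 then -1 else 1) else 0 : ℤ) *
        (if y.2.1 + y.2.2 = k.2.1 then (if k.2.2 = 1 ∧ y.2.1 = 1 then -1 else 1) else 0)) =
      (if x.1.1 + x.1.2 = (cnotLabel c k).1.1 then
          (if (cnotLabel c k).1.2 = 1 ∧ x.1.1 = 1 then -1 else 1) else 0) *
        (if x.2.1 + x.2.2 = (cnotLabel c k).2.1 then
          (if (cnotLabel c k).2.2 = 1 ∧ x.2.1 = 1 then -1 else 1) else 0) := by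
    simp only [forall_eq]
    decide
  have := congrArg (Int.cast : ℤ → ℂ) (key c k x (π x) rfl)
  push_cast at this
  linear_combination ((√2 : ℝ) : ℂ)⁻¹ * ((√2 : ℝ) : ℂ)⁻¹ * this

/-! ### Symplectic label maps of circuits -/

/-- The permutations of labels that fix the label of `|φ⁺⟩|φ⁺⟩` and preserve the symplectic
form. -/
def IsSymplectic (σ : Equiv.Perm (Two × Two)) : Prop :=
  σ 0 = 0 ∧ ∀ k l, symplecticForm (σ k) (σ l) = symplecticForm k l

theorem IsSymplectic.mul {σ τ : Equiv.Perm (Two × Two)} (hσ : IsSymplectic σ)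
    (hτ : IsSymplectic τ) : IsSymplectic (σ * τ) :=
  ⟨by simp [hσ.1, hτ.1], fun k l => by simp [hσ.2, hτ.2]⟩

theorem IsSymplectic.inv {σ : Equiv.Perm (Two × Two)} (hσ : IsSymplectic σ) :
    IsSymplectic σ⁻¹ :=
  ⟨by rw [Equiv.Perm.inv_eq_iff_eq, hσ.1], fun k l => by
    rw [← hσ.2]; simp⟩

theorem isSymplectic_onPair_hadamardLabel (q : Fin 2) : IsSymplectic (onPair q hadamardLabel) := by
  unfold IsSymplectic
  revert q
  decide

theorem isSymplectic_onPair_phaseLabel (q : Fin 2) : IsSymplectic (onPair q phaseLabel) := by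
  unfold IsSymplectic
  revert q
  decide

theorem isSymplectic_cnotLabel (c : Fin 2) : IsSymplectic (cnotLabel c) := by
  unfold IsSymplectic
  revert c
  decide

theorem onQubit_conj_bellProj₂ {A : Matrix (Fin 2) (Fin 2) ℂ} {e : Equiv.Perm Two}
    (h : ∀ k, ∃ μ : ℂ, μ * star μ = 1 ∧ (Aᵀ ⊗ₖ Aᴴ) *ᵥ bellVec k = μ • bellVec (e k))
    (q : Fin 2) (k : Two × Two) :
    bilocal (onQubit q A)ᵀ (onQubit q A)ᴴ * bellProj₂ k *
      (bilocal (onQubit q A)ᵀ (onQubit q A)ᴴ)ᴴ = bellProj₂ (onPair q e k) := by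
  rw [onQubit_transpose, onQubit_conjTranspose, bilocal_onQubit]
  unfold onPair
  obtain ⟨k₁, k₂⟩ := k
  split_ifs
  · obtain ⟨μ, hμ, hk⟩ := h k₁
    exact bellProj₂_conj hμ (kronecker_one_mulVec_bellVec₂ hk k₂)
  · obtain ⟨μ, hμ, hk⟩ := h k₂
    exact bellProj₂_conj hμ (one_kronecker_mulVec_bellVec₂ hk k₁)

theorem CliffordGate.exists_label (g : CliffordGate) : ∃ σ, IsSymplectic σ ∧ ∀ k,
    bilocal g.toMatrixᵀ g.toMatrixᴴ * bellProj₂ k * (bilocal g.toMatrixᵀ g.toMatrixᴴ)ᴴ =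
      bellProj₂ (σ k) := by
  cases g with
  | H q => exact ⟨_, isSymplectic_onPair_hadamardLabel q,
      onQubit_conj_bellProj₂ hadamard_mulVec_bellVec q⟩
  | S q => exact ⟨_, isSymplectic_onPair_phaseLabel q,
      onQubit_conj_bellProj₂ phaseGate_mulVec_bellVec q⟩
  | CNOT c =>
    refine ⟨_, isSymplectic_cnotLabel c, fun k => ?_⟩
    simp only [CliffordGate.toMatrix, cnot_transpose, cnot_conjTranspose]
    exact bellProj₂_conj (μ := 1) (by simp) (by rw [cnot_mulVec_bellVec₂, one_smul])

theorem CliffordCircuit.exists_label (c : CliffordCircuit) : ∃ σ, IsSymplectic σ ∧ ∀ k,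
    bilocal c.toMatrixᵀ c.toMatrixᴴ * bellProj₂ k * (bilocal c.toMatrixᵀ c.toMatrixᴴ)ᴴ =
      bellProj₂ (σ k) := by
  induction c with
  | nil =>
    refine ⟨1, ⟨rfl, fun _ _ => rfl⟩, fun k => ?_⟩
    simp [CliffordCircuit.toMatrix, bilocal_one]
  | cons g c ih =>
    obtain ⟨σ, hσ, h⟩ := ih
    obtain ⟨τ, hτ, h'⟩ := g.exists_label
    -- Transpose and adjoint reverse products, so the head gate acts first.
    refine ⟨σ * τ, hσ.mul hτ, fun k => ?_⟩
    have hc : CliffordCircuit.toMatrix (g :: c) = g.toMatrix * CliffordCircuit.toMatrix c := by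
      simp [CliffordCircuit.toMatrix]
    rw [hc, Matrix.transpose_mul, Matrix.conjTranspose_mul, bilocal_mul, Matrix.conjTranspose_mul,
      Equiv.Perm.mul_apply, ← h, ← h']
    simp only [Matrix.mul_assoc]

/-! ### Measurement of the second pair -/

/-- The weight, after a success, of the Bell vector with label `k` in the unnormalised state of the
pair kept, when the labels are permuted by `σ` and `c` are the coefficients of the input. -/
def keptWeight (σ : Equiv.Perm (Two × Two)) (c : Two × Two → ℝ) (k : Two) : ℝ :=
  c (σ⁻¹ (k, (0, 0))) + c (σ⁻¹ (k, (0, 1)))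

/-- The coefficients of a Werner state and a Bell-diagonal state. -/
def inputCoeff (F f l₁ l₂ l₃ : ℝ) (k : Two × Two) : ℝ :=
  bellCoeff F ((1 - F) / 3) ((1 - F) / 3) ((1 - F) / 3) k.1 * bellCoeff f l₁ l₂ l₃ k.2

theorem bellVec_diag_mul_star (k : Two) (m : Fin 2) :
    bellVec k (m, m) * star (bellVec k (m, m)) = if k.1 = 0 then 1 / 2 else 0 := by
  obtain ⟨x, z⟩ := k
  fin_cases x <;> fin_cases z <;> fin_cases m <;> simp [bellVec, ← mul_inv, ← Complex.ofReal_mul]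

/-- The vectors `|φ^±⟩` give each pair of equal outcomes with probability `1/2`, and `|ψ^±⟩` never
do; hence the state left does not depend on `m`. -/
theorem bellProj₂_submatrix (k : Two × Two) (m : Fin 2) :
    (bellProj₂ k).submatrix (fun x => (x, (m, m))) (fun x => (x, (m, m))) =
      (if k.2.1 = 0 then 1 / 2 else 0 : ℂ) • ketbra (bellVec k.1) := by
  ext x y
  rw [← bellVec_diag_mul_star k.2 m]
  simp only [bellProj₂, bellVec₂, ketbra, Matrix.submatrix_apply, Matrix.vecMulVec_apply,
    Pi.star_apply, star_mul', Matrix.smul_apply, smul_eq_mul]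
  ring

namespace BilocalCliffordProtocol

theorem exists_measured_eq (P : BilocalCliffordProtocol) : ∃ σ, IsSymplectic σ ∧
    ∀ F f l₁ l₂ l₃ m, P.measured (werner F) (bellDiagonal f l₁ l₂ l₃) m =
      ∑ k, ((keptWeight σ (inputCoeff F f l₁ l₂ l₃) k / 2 : ℝ) : ℂ) • ketbra (bellVec k) := by
  obtain ⟨σ, hσ, h⟩ := CliffordCircuit.exists_label P.circuit
  refine ⟨σ, hσ, fun F f l₁ l₂ l₃ m => ?_⟩
  have hr : P.rotated (werner F) (bellDiagonal f l₁ l₂ l₃) =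
      ∑ k, ((inputCoeff F f l₁ l₂ l₃ (σ⁻¹ k) : ℝ) : ℂ) • bellProj₂ k := by
    rw [rotated, werner, bellDiagonal_kronecker, Finset.mul_sum, Finset.sum_mul]
    refine Eq.trans ?_ (Equiv.sum_comp σ _)
    refine Finset.sum_congr rfl fun k _ => ?_
    rw [Matrix.mul_smul, Matrix.smul_mul, h]
    simp [inputCoeff]
  have hs : P.measured (werner F) (bellDiagonal f l₁ l₂ l₃) m =
      ∑ k, ((inputCoeff F f l₁ l₂ l₃ (σ⁻¹ k) : ℝ) : ℂ) •
        ((if k.2.1 = 0 then 1 / 2 else 0 : ℂ) • ketbra (bellVec k.1)) := by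
    simp only [← bellProj₂_submatrix _ m]
    rw [measured, hr]
    ext x y
    simp only [Matrix.submatrix_apply, Matrix.sum_apply, Matrix.smul_apply]
  rw [hs, Fintype.sum_prod_type (α₁ := Two)]
  refine Finset.sum_congr rfl fun k _ => ?_
  simp only [Fintype.sum_prod_type, Fin.sum_univ_two, Fin.isValue, one_ne_zero, if_true, if_false,
    smul_smul, ← add_smul, keptWeight]
  push_cast
  congr 1
  ring

end BilocalCliffordProtocol

/-! ### Fidelity and local corrections -/

theorem star_dotProduct_ketbra_mulVec (u v : Two → ℂ) :
    star u ⬝ᵥ (ketbra v *ᵥ u) = (Complex.normSq (star u ⬝ᵥ v) : ℂ) := by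
  rw [ketbra, Matrix.vecMulVec_mulVec, Complex.normSq_eq_conj_mul_self, ← Complex.star_def,
    Matrix.star_dotProduct v u]
  simp [mul_comm]

theorem fidelity_ketbra_nonneg (v : Two → ℂ) : 0 ≤ fidelity (ketbra v) := by
  rw [fidelity, star_dotProduct_ketbra_mulVec, Complex.ofReal_re]
  exact Complex.normSq_nonneg _

theorem fidelity_ketbra_bellVec (k : Two) :
    fidelity (ketbra (bellVec k)) = if k = (0, 0) then 1 else 0 := by
  rw [fidelity, star_dotProduct_ketbra_mulVec, Complex.ofReal_re, phiPlus_eq]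
  obtain ⟨x, z⟩ := k
  fin_cases x <;> fin_cases z <;>
    simp [dotProduct, Fintype.sum_prod_type, Fin.sum_univ_two, bellVec, ← mul_inv,
      ← Complex.ofReal_mul]
  norm_num

theorem trace_ketbra_bellVec (k : Two) : (ketbra (bellVec k)).trace = 1 := by
  obtain ⟨x, z⟩ := k
  fin_cases x <;> fin_cases z <;>
    simp [Matrix.trace, ketbra, Matrix.vecMulVec_apply, Fintype.sum_prod_type, Fin.sum_univ_two,
      bellVec, ← mul_inv, ← Complex.ofReal_mul] <;> norm_num

theorem sum_ketbra_bellVec : ∑ k, ketbra (bellVec k) = 1 := by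
  ext ⟨a, b⟩ ⟨c, d⟩
  fin_cases a <;> fin_cases b <;> fin_cases c <;> fin_cases d <;>
    simp [ketbra, Matrix.vecMulVec_apply, Matrix.sum_apply,
      Fintype.sum_prod_type, Fin.sum_univ_two, bellVec, ← mul_inv, ← Complex.ofReal_mul] <;>
    norm_num

theorem fidelity_sum {ι : Type*} (s : Finset ι) (a : ι → ℝ) (A : ι → Matrix Two Two ℂ) :
    fidelity (∑ i ∈ s, (a i : ℂ) • A i) = ∑ i ∈ s, a i * fidelity (A i) := by
  simp only [fidelity, Matrix.sum_mulVec, dotProduct_sum, Matrix.smul_mulVec, dotProduct_smul,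
    Complex.re_sum, smul_eq_mul, Complex.re_ofReal_mul]

/-- The fidelity of the Bell vector with label `k` after a local unitary `U ⊗ V`. -/
def correctedFidelity (U V : Matrix.unitaryGroup (Fin 2) ℂ) (k : Two) : ℝ :=
  fidelity ((U.1 ⊗ₖ V.1) * ketbra (bellVec k) * (U.1 ⊗ₖ V.1)ᴴ)

theorem correctedFidelity_nonneg (U V : Matrix.unitaryGroup (Fin 2) ℂ) (k : Two) :
    0 ≤ correctedFidelity U V k := by
  rw [correctedFidelity, ketbra, Matrix.mul_vecMulVec, Matrix.vecMulVec_mul, ← Matrix.star_mulVec]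
  exact fidelity_ketbra_nonneg _

theorem correctedFidelity_one (k : Two) :
    correctedFidelity 1 1 k = if k = (0, 0) then 1 else 0 := by
  rw [← fidelity_ketbra_bellVec, correctedFidelity]
  simp

/-- The Bell projectors resolve the identity, which unitary conjugation preserves. -/
theorem sum_correctedFidelity (U V : Matrix.unitaryGroup (Fin 2) ℂ) :
    ∑ k, correctedFidelity U V k = 1 := by
  have h1 : (U.1 ⊗ₖ V.1) * (U.1 ⊗ₖ V.1)ᴴ = 1 := by
    rw [Matrix.conjTranspose_kronecker, ← Matrix.mul_kronecker_mul,
      ← Matrix.star_eq_conjTranspose, ← Matrix.star_eq_conjTranspose,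
      Unitary.mul_star_self_of_mem U.2, Unitary.mul_star_self_of_mem V.2, Matrix.one_kronecker_one]
  have h2 := fidelity_sum Finset.univ (fun _ => 1)
    (fun k => (U.1 ⊗ₖ V.1) * ketbra (bellVec k) * (U.1 ⊗ₖ V.1)ᴴ)
  have h3 := fidelity_sum Finset.univ (fun _ => 1) (fun k => ketbra (bellVec k))
  simp only [Complex.ofReal_one, one_smul, one_mul] at h2 h3
  simp only [correctedFidelity]
  rw [← h2, ← Finset.sum_mul, ← Finset.mul_sum, sum_ketbra_bellVec, Matrix.mul_one, h1,
    ← sum_ketbra_bellVec, h3]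
  simp [fidelity_ketbra_bellVec]

namespace BilocalCliffordProtocol

/-- The probability that the local unitaries after success turn the Bell vector with label `k` into
`|φ⁺⟩`, averaged over the two outcomes. -/
def correctionWeight (P : BilocalCliffordProtocol) (k : Two) : ℝ :=
  (∑ m, correctedFidelity (P.corrA m) (P.corrB m) k) / 2

theorem correctionWeight_nonneg (P : BilocalCliffordProtocol) (k : Two) :
    0 ≤ P.correctionWeight k :=
  div_nonneg (Finset.sum_nonneg fun _ _ => correctedFidelity_nonneg _ _ _) zero_le_two

theorem sum_correctionWeight (P : BilocalCliffordProtocol) : ∑ k, P.correctionWeight k = 1 := by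
  simp only [correctionWeight]
  rw [← Finset.sum_div, Finset.sum_comm]
  simp [sum_correctedFidelity]

theorem correctionWeight_uncorrected (P : BilocalCliffordProtocol) (k : Two) :
    P.uncorrected.correctionWeight k = if k = (0, 0) then 1 else 0 := by
  simp only [correctionWeight, uncorrected, correctedFidelity_one]
  split_ifs <;> simp

section

variable {P : BilocalCliffordProtocol} {ρ₁ ρ₂ : Matrix Two Two ℂ} {n : Two → ℝ}

theorem successProbOn_eq
    (h : ∀ m, P.measured ρ₁ ρ₂ m = ∑ k, ((n k / 2 : ℝ) : ℂ) • ketbra (bellVec k)) :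
    P.successProbOn ρ₁ ρ₂ = ∑ k, n k := by
  simp only [successProbOn, h, Matrix.trace_sum, Matrix.trace_smul, trace_ketbra_bellVec,
    smul_eq_mul, mul_one, ← Complex.ofReal_sum, Complex.ofReal_re, Fin.sum_univ_two]
  rw [← Finset.sum_add_distrib]
  exact Finset.sum_congr rfl fun k _ => by ring

/-- Both outcomes leave the same state, so the corrections enter only through their average. -/
theorem fidelity_output_eq
    (h : ∀ m, P.measured ρ₁ ρ₂ m = ∑ k, ((n k / 2 : ℝ) : ℂ) • ketbra (bellVec k)) :
    fidelity (P.output ρ₁ ρ₂) = (∑ k, P.correctionWeight k * n k) / ∑ k, n k := by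
  have e : P.output ρ₁ ρ₂ = ∑ x : Fin 2 × Two, (((∑ k, n k)⁻¹ * (n x.2 / 2) : ℝ) : ℂ) •
      (((P.corrA x.1).1 ⊗ₖ (P.corrB x.1).1) * ketbra (bellVec x.2) *
        ((P.corrA x.1).1 ⊗ₖ (P.corrB x.1).1)ᴴ) := by
    rw [output, successProbOn_eq h, Fintype.sum_prod_type (α₂ := Two), Finset.smul_sum]
    refine Finset.sum_congr rfl fun m _ => ?_
    rw [h, Matrix.mul_sum, Matrix.sum_mul, Finset.smul_sum]
    refine Finset.sum_congr rfl fun k _ => ?_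
    rw [Matrix.mul_smul, Matrix.smul_mul, smul_smul]
    push_cast
    rfl
  rw [e, fidelity_sum, Fintype.sum_prod_type_right (α₂ := Two), Finset.sum_div]
  refine Finset.sum_congr rfl fun k _ => ?_
  simp only [correctionWeight, correctedFidelity]
  rw [← Finset.mul_sum]
  ring

end

end BilocalCliffordProtocol

/-! ### Reduction to a single label -/

theorem sum_keptWeight {σ : Equiv.Perm (Two × Two)} (hσ : IsSymplectic σ) (c : Two × Two → ℝ) :
    ∑ k, keptWeight σ c k =
      ∑ u, if symplecticForm u (σ⁻¹ (0, (0, 1))) = 0 then c u else 0 := by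
  have h : ∀ q : Two × Two, symplecticForm q (0, (0, 1)) = 0 ↔ q.2.1 = 0 := by decide
  rw [← Equiv.sum_comp σ⁻¹, Fintype.sum_prod_type (α₁ := Two)]
  refine Finset.sum_congr rfl fun k _ => ?_
  simp only [hσ.inv.2, h]
  simp [keptWeight, Fintype.sum_prod_type, Fin.sum_univ_two]

theorem keptWeight_zero {σ : Equiv.Perm (Two × Two)} (hσ : IsSymplectic σ) (c : Two × Two → ℝ) :
    keptWeight σ c (0, 0) = c 0 + c (σ⁻¹ (0, (0, 1))) := by
  rw [keptWeight, show ((0, 0), (0, 0)) = (0 : Two × Two) from rfl, hσ.inv.1]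
  rfl

/-- Different kept labels draw on disjoint input labels. Hence, for total weight `1`, a kept weight
above `1/2` is strictly the largest. -/
theorem keptWeight_add_le {σ : Equiv.Perm (Two × Two)} {c : Two × Two → ℝ} (hc : ∀ u, 0 ≤ c u)
    {k l : Two} (hkl : k ≠ l) : keptWeight σ c k + keptWeight σ c l ≤ ∑ u, c u := by
  have h0 : ∀ k, 0 ≤ keptWeight σ c k := fun k => add_nonneg (hc _) (hc _)
  calc keptWeight σ c k + keptWeight σ c l = ∑ j ∈ {k, l}, keptWeight σ c j :=
        (Finset.sum_pair hkl).symm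
    _ ≤ ∑ j, keptWeight σ c j :=
        Finset.sum_le_sum_of_subset_of_nonneg (Finset.subset_univ _) fun j _ _ => h0 j
    _ ≤ ∑ u, c u := by
        rw [← Equiv.sum_comp σ⁻¹ c, Fintype.sum_prod_type (α₁ := Two)]
        refine Finset.sum_le_sum fun j _ => ?_
        simp only [keptWeight, Fintype.sum_prod_type, Fin.sum_univ_two]
        linarith [hc (σ⁻¹ (j, (1, 0))), hc (σ⁻¹ (j, (1, 1)))]

theorem bellCoeff_nonneg {F l₁ l₂ l₃ : ℝ} (hF : 0 ≤ F) (h₁ : 0 ≤ l₁) (h₂ : 0 ≤ l₂) (h₃ : 0 ≤ l₃)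
    (k : Two) : 0 ≤ bellCoeff F l₁ l₂ l₃ k := by
  unfold bellCoeff
  split_ifs <;> assumption

theorem sum_bellCoeff (F l₁ l₂ l₃ : ℝ) : ∑ k, bellCoeff F l₁ l₂ l₃ k = F + l₁ + l₂ + l₃ := by
  simp [bellCoeff, Fintype.sum_prod_type, Fin.sum_univ_two]
  ring

theorem sum_inputCoeff {F f l₁ l₂ l₃ : ℝ} (h : f + l₁ + l₂ + l₃ = 1) :
    ∑ u, inputCoeff F f l₁ l₂ l₃ u = 1 := by
  simp only [inputCoeff]
  rw [Fintype.sum_prod_type (α₁ := Two), ← Fintype.sum_mul_sum, sum_bellCoeff, sum_bellCoeff, h]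
  ring

/-- A convex combination that is at least its strictly largest term is that term. -/
theorem weight_eq_one_of_le {ι : Type*} [Fintype ι] [DecidableEq ι] {w n : ι → ℝ} {i : ι}
    (hw : ∀ j, 0 ≤ w j) (hsum : ∑ j, w j = 1) (hn : ∀ j, j ≠ i → n j < n i)
    (h : n i ≤ ∑ j, w j * n j) (j : ι) : w j = if j = i then 1 else 0 := by
  -- A sum of nonnegative terms that is at most zero, so every term vanishes.
  have h0 : ∑ j, w j * (n i - n j) = 0 := by
    refine le_antisymm ?_ (Finset.sum_nonneg fun j _ => mul_nonneg (hw j) ?_)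
    · simp only [mul_sub, Finset.sum_sub_distrib, ← Finset.sum_mul, hsum]
      linarith
    · by_cases hj : j = i
      · simp [hj]
      · linarith [hn j hj]
  have h1 : ∀ j, j ≠ i → w j = 0 := by
    intro j hj
    have := (Finset.sum_eq_zero_iff_of_nonneg fun j _ => mul_nonneg (hw j) (by
      by_cases hj : j = i
      · simp [hj]
      · linarith [hn j hj])).1 h0 j (Finset.mem_univ j)
    rcases mul_eq_zero.1 this with h | h
    · exact h
    · linarith [hn j hj]
  split_ifs with hj
  · rw [Finset.sum_eq_single i (fun k _ hk => h1 k hk) (by simp)] at hsum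
    rw [hj, hsum]
  · exact h1 j hj

/-- The jump function and the success probability, in terms of the preimage `v` of the label of
`|φ⁺⟩|φ⁻⟩`, when the local unitaries do not lower the fidelity at `F = 1`. -/
theorem exists_jump_eq {f l₁ l₂ l₃ : ℝ} (hf : 1 / 2 < f) (h₁ : 0 ≤ l₁) (h₂ : 0 ≤ l₂)
    (h₃ : 0 ≤ l₃) (hsum : f + l₁ + l₂ + l₃ = 1) (P : BilocalCliffordProtocol)
    (hcorr : P.uncorrected.jump 1 (bellDiagonal f l₁ l₂ l₃) ≤
      P.jump 1 (bellDiagonal f l₁ l₂ l₃)) :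
    ∃ v : Two × Two, v ≠ 0 ∧ ∀ F,
      P.successProb F (bellDiagonal f l₁ l₂ l₃) =
        (∑ u, if symplecticForm u v = 0 then inputCoeff F f l₁ l₂ l₃ u else 0) ∧
      P.jump F (bellDiagonal f l₁ l₂ l₃) =
        (inputCoeff F f l₁ l₂ l₃ 0 + inputCoeff F f l₁ l₂ l₃ v) /
          ∑ u, if symplecticForm u v = 0 then inputCoeff F f l₁ l₂ l₃ u else 0 := by
  obtain ⟨σ, hσ, h⟩ := P.exists_measured_eq
  have hj := fun F => BilocalCliffordProtocol.fidelity_output_eq (h F f l₁ l₂ l₃)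
  have hu : ∀ F, P.uncorrected.jump F (bellDiagonal f l₁ l₂ l₃) =
      (∑ k, P.uncorrected.correctionWeight k * keptWeight σ (inputCoeff F f l₁ l₂ l₃) k) /
        ∑ k, keptWeight σ (inputCoeff F f l₁ l₂ l₃) k := fun F =>
    BilocalCliffordProtocol.fidelity_output_eq (P := P.uncorrected) (h F f l₁ l₂ l₃)
  have hc : ∀ u, 0 ≤ inputCoeff 1 f l₁ l₂ l₃ u := fun u =>
    mul_nonneg (bellCoeff_nonneg (by norm_num) (by norm_num) (by norm_num) (by norm_num) _)
      (bellCoeff_nonneg (by linarith) h₁ h₂ h₃ _)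
  have h0 : 1 / 2 < keptWeight σ (inputCoeff 1 f l₁ l₂ l₃) (0, 0) := by
    rw [keptWeight_zero hσ]
    have : inputCoeff 1 f l₁ l₂ l₃ 0 = f := by simp [inputCoeff, bellCoeff]
    linarith [hc (σ⁻¹ (0, (0, 1)))]
  have hpos : 0 < ∑ k, keptWeight σ (inputCoeff 1 f l₁ l₂ l₃) k :=
    Finset.sum_pos' (fun k _ => add_nonneg (hc _) (hc _)) ⟨(0, 0), Finset.mem_univ _, by linarith⟩
  -- These weights do not involve `F`, so the comparison at `F = 1` determines them for all `F`.
  have hw : ∀ k, P.correctionWeight k = if k = (0, 0) then 1 else 0 := by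
    refine weight_eq_one_of_le (n := keptWeight σ (inputCoeff 1 f l₁ l₂ l₃))
      P.correctionWeight_nonneg P.sum_correctionWeight (fun k hk => ?_) ?_
    · have := keptWeight_add_le (σ := σ) hc hk
      rw [sum_inputCoeff hsum] at this
      linarith
    · rw [hu, BilocalCliffordProtocol.jump, hj, div_le_div_iff_of_pos_right hpos] at hcorr
      simpa [BilocalCliffordProtocol.correctionWeight_uncorrected] using hcorr
  refine ⟨σ⁻¹ (0, (0, 1)), fun hv => ?_, fun F => ⟨?_, ?_⟩⟩
  · rw [← hσ.inv.1] at hv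
    exact absurd (σ⁻¹.injective hv) (by decide)
  · rw [← sum_keptWeight hσ]
    exact BilocalCliffordProtocol.successProbOn_eq (h F f l₁ l₂ l₃)
  · rw [← sum_keptWeight hσ, ← keptWeight_zero hσ, BilocalCliffordProtocol.jump, hj]
    simp [hw]

/-- The jump function and the success probability of a protocol are those of one of three types. -/
theorem jump_cases {f l₁ l₂ l₃ : ℝ} (hf : 1 / 2 < f) (h₁ : 0 ≤ l₁) (h₂ : 0 ≤ l₂)
    (h₃ : 0 ≤ l₃) (hsum : f + l₁ + l₂ + l₃ = 1) (P : BilocalCliffordProtocol)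
    (hcorr : P.uncorrected.jump 1 (bellDiagonal f l₁ l₂ l₃) ≤
      P.jump 1 (bellDiagonal f l₁ l₂ l₃)) :
    (∀ F ∈ Set.Icc (0 : ℝ) 1, P.jump F (bellDiagonal f l₁ l₂ l₃) = F) ∨
    (∀ F ∈ Set.Icc (0 : ℝ) 1, P.jump F (bellDiagonal f l₁ l₂ l₃) = f) ∨
    ∃ l, (l = l₁ ∨ l = l₂ ∨ l = l₃) ∧ ∀ F,
      P.successProb F (bellDiagonal f l₁ l₂ l₃) =
        (2 - 2 * F + (f + l) * (4 * F - 1)) / 3 ∧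
      P.jump F (bellDiagonal f l₁ l₂ l₃) = jumpFormula f l F := by
  obtain ⟨⟨a, b⟩, hv, h⟩ := exists_jump_eq hf h₁ h₂ h₃ hsum P hcorr
  have hl : ∀ k, 0 ≤ bellCoeff f l₁ l₂ l₃ k :=
    bellCoeff_nonneg (by linarith) h₁ h₂ h₃
  by_cases ha : a = 0
  · left
    subst ha
    have hb : b ≠ 0 := by
      rintro rfl
      exact hv rfl
    intro F _
    have hp : (∑ u, if symplecticForm u (0, b) = 0 then inputCoeff F f l₁ l₂ l₃ u else 0) =
        f + bellCoeff f l₁ l₂ l₃ b := by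
      clear h hv
      obtain ⟨x, z⟩ := b
      fin_cases x <;> fin_cases z <;>
        simp [Fintype.sum_prod_type, Fin.sum_univ_two, symplecticForm, inputCoeff,
          bellCoeff] at hb ⊢ <;>
        ring
    rw [(h F).2, hp, div_eq_iff (by linarith [hl b])]
    simp only [inputCoeff]
    rw [show bellCoeff F _ _ _ (0 : Two × Two).1 = F from rfl,
      show bellCoeff F _ _ _ (0 : Two) = F from rfl,
      show bellCoeff f l₁ l₂ l₃ (0 : Two × Two).2 = f from rfl]
    ring
  · have hW : ∀ F, bellCoeff F ((1 - F) / 3) ((1 - F) / 3) ((1 - F) / 3) a = (1 - F) / 3 := by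
      intro F
      obtain ⟨x, z⟩ := a
      fin_cases x <;> fin_cases z <;> simp [bellCoeff] at ha ⊢
    by_cases hb : b = 0
    · right; left
      subst hb
      intro F hF
      have hp : (∑ u, if symplecticForm u (a, 0) = 0 then inputCoeff F f l₁ l₂ l₃ u else 0) =
          (1 + 2 * F) / 3 := by
        clear h hv hW
        -- The factor `1` is inserted so that both sides are linear in the coefficients of the
        -- second state.
        have e : (1 + 2 * F) / 3 = (1 + 2 * F) / 3 * (f + l₁ + l₂ + l₃) := by rw [hsum, mul_one]
        rw [e]
        obtain ⟨x, z⟩ := a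
        fin_cases x <;> fin_cases z <;>
          simp [Fintype.sum_prod_type, Fin.sum_univ_two, symplecticForm, inputCoeff,
            bellCoeff] at ha ⊢ <;>
          ring
      rw [(h F).2, hp, div_eq_iff (by linarith [hF.1]), inputCoeff, inputCoeff, hW]
      simp [bellCoeff]
      ring
    · right; right
      refine ⟨bellCoeff f l₁ l₂ l₃ b, ?_, fun F => ?_⟩
      · obtain ⟨x, z⟩ := b
        fin_cases x <;> fin_cases z <;> simp [bellCoeff] at hb ⊢
      have hp : (∑ u, if symplecticForm u (a, b) = 0 then inputCoeff F f l₁ l₂ l₃ u else 0) =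
          (2 - 2 * F + (f + bellCoeff f l₁ l₂ l₃ b) * (4 * F - 1)) / 3 := by
        clear h hv hW
        obtain rfl : f = 1 - l₁ - l₂ - l₃ := by linarith
        obtain ⟨x, z⟩ := a
        obtain ⟨x', z'⟩ := b
        fin_cases x <;> fin_cases z <;> (try exact absurd rfl ha) <;>
        fin_cases x' <;> fin_cases z' <;> (try exact absurd rfl hb) <;>
        simp [Fintype.sum_prod_type, Fin.sum_univ_two, symplecticForm, inputCoeff,
          bellCoeff] <;>
        ring
      rw [(h F).1, (h F).2, hp, jumpFormula, inputCoeff, inputCoeff, hW]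
      refine ⟨rfl, ?_⟩
      simp [bellCoeff]

end EntanglementBuffer

end

/-! ### The theorem -/

theorem lemma2
    -- the Bell-diagonal state: a normalised state of fidelity larger than one half
    (Fnew l₁ l₂ l₃ : ℝ) (hF : 1 / 2 < Fnew) (h₁ : 0 ≤ l₁) (h₂ : 0 ≤ l₂) (h₃ : 0 ≤ l₃)
    (hsum : Fnew + l₁ + l₂ + l₃ = 1)
    (ρnew : Matrix EntanglementBuffer.Two EntanglementBuffer.Two ℂ)
    (hρ : ρnew = EntanglementBuffer.bellDiagonal Fnew l₁ l₂ l₃)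
    (lmin lmax : ℝ) (hlmin : lmin = min l₁ (min l₂ l₃)) (hlmax : lmax = max l₁ (max l₂ l₃))
    (P : EntanglementBuffer.BilocalCliffordProtocol)
    -- the local unitaries applied after a success do not lower the output fidelity
    (hcorr : ∀ F ∈ Set.Icc (1 / 4 : ℝ) 1, P.uncorrected.jump F ρnew ≤ P.jump F ρnew)
    -- the protocol is nontrivial: its jump function is neither `F` nor the constant `Fnew`
    (hJF : ¬ ∀ F ∈ Set.Icc (0 : ℝ) 1, P.jump F ρnew = F)
    (hJnew : ¬ ∀ F ∈ Set.Icc (0 : ℝ) 1, P.jump F ρnew = Fnew) :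
    (∀ F ∈ Set.Icc (1 / 4 : ℝ) (EntanglementBuffer.Fstar Fnew lmin),
      EntanglementBuffer.aLower Fnew lmin lmax * F + EntanglementBuffer.bLower Fnew lmin lmax
        ≤ P.jump F ρnew) ∧
    (∀ F ∈ Set.Icc (1 / 4 : ℝ) 1,
      P.jump F ρnew ≤ EntanglementBuffer.aUpper Fnew * F + EntanglementBuffer.bUpper Fnew) ∧
    (∀ F ∈ Set.Icc (1 / 4 : ℝ) 1,
      1 / 2 ≤ P.successProb F ρnew ∧ P.successProb F ρnew ≤ Fnew + lmax) := by
  subst hρ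
  rcases EntanglementBuffer.jump_cases hF h₁ h₂ h₃ hsum P (hcorr 1 (by norm_num)) with
    h | h | ⟨l, hl, h⟩
  · exact absurd h hJF
  · exact absurd h hJnew
  have hm : 0 ≤ lmin := hlmin ▸ le_min h₁ (le_min h₂ h₃)
  have hml : lmin ≤ l := by
    rw [hlmin]
    rcases hl with rfl | rfl | rfl <;> simp
  have hlM : l ≤ lmax := by
    rw [hlmax]
    rcases hl with rfl | rfl | rfl <;> simp
  have hl0 : 0 ≤ l := hm.trans hml
  have hl1 : Fnew + l ≤ 1 := by rcases hl with rfl | rfl | rfl <;> linarith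
  refine ⟨fun F hFI => ?_, fun F hFI => ?_, fun F hFI => ?_⟩
  · rw [(h F).2]
    exact EntanglementBuffer.aLower_mul_add_bLower_le hF hm hml hlM hl1 hFI.1 hFI.2
  · rw [(h F).2]
    exact EntanglementBuffer.jumpFormula_le hF hl0 hl1 hFI.1 hFI.2
  · rw [(h F).1]
    have := EntanglementBuffer.prob_le (s := Fnew + l) (by linarith) hFI.2
    exact ⟨EntanglementBuffer.half_le_prob (by linarith) hFI.1, by linarith⟩
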